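/- Conventions. All topological groups and spaces below are Hausdorff, and spaces acted upon are non-empty. Let $G$ be a locally compact group. $G$ is *amenable* if it fixes a point in every non-empty convex compact $G$-space, i.e. every non-empty convex compact subset of a Hausdorff locally convex topological vector space endowed with a continuous affine $G$-action. $G$ is *amenable-by-discrete* if it has an amenable open normal subgroup. A continuous action of $G$ on a locally compact space $X$ is *amenable* if there is a net of weak-* continuous maps $x\mapsto m_i^x$ from $X$ to the space of (Radon) probability measures on $G$ such that $\|s\,m_i^x-m_i^{sx}\|_1\to 0$ uniformly for $(x,s)$ in compact subsets of $X\times G$. $G$ is *amenable at infinity* if it admits an amenable continuous action on some compact space. $\mathrm{C}_\mathrm{b}(X)$ is the space of bounded continuous real functions on $X$ with the sup-norm, on which $G$ acts by $(gf)(x)=f(g^{-1}x)$. Theorem. Let $G$ be any $\sigma$-compact locally compact group. The following are equivalent: (i) $G$ admits an amenable continuous action on a $\sigma$-compact locally compact space $X$ such that the $G$-representation on $\mathrm{C}_\mathrm{b}(X)$ is continuous (for the sup-norm). (ii) $G$ is either amenable at infinity or amenable-by-discrete. -/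

import Mathlib

open MeasureTheory BoundedContinuousFunction
open scoped ZeroAtInfty

universe u

/-- A topological group `G` is amenable if it fixes a point in every non-empty convex compact
`G`-space, that is, in every non-empty convex compact subset `K` of a Hausdorff locally convex
real topological vector space, endowed with a (jointly) continuous action of `G` on `K` by affine
maps. (Spaces in the universe of `G` suffice: for locally compact `G` the universal such space is
a set of functionals on a space of real functions on `G`.) -/
def IsAmenableGroup (G : Type u) [Group G] [TopologicalSpace G] : Prop :=
  ∀ (E : Type u) [AddCommGroup E] [Module ℝ E] [TopologicalSpace E] [IsTopologicalAddGroup E]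
    [ContinuousSMul ℝ E] [LocallyConvexSpace ℝ E] [T2Space E]
    (K : Set E) [MulAction G K] [ContinuousSMul G K],
    IsCompact K → Convex ℝ K → K.Nonempty →
    (∀ (g : G) (x y z : K) (a b : ℝ), 0 ≤ a → 0 ≤ b → a + b = 1 →
      (z : E) = a • (x : E) + b • (y : E) →
      ((g • z : K) : E) = a • ((g • x : K) : E) + b • ((g • y : K) : E)) →
    ∃ x : K, ∀ g : G, g • x = x

/-- `G` is amenable-by-discrete: it has an amenable normal subgroup with discrete quotient,
i.e. an amenable open normal subgroup. -/
def IsAmenableByDiscrete (G : Type u) [Group G] [TopologicalSpace G] : Prop :=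
  ∃ A : Subgroup G, A.Normal ∧ IsOpen (A : Set G) ∧ IsAmenableGroup A

/-- The total variation norm `‖μ - ν‖₁` of the difference of two finite measures. -/
noncomputable def tvDist {G : Type*} [MeasurableSpace G] (μ ν : Measure G)
    [IsFiniteMeasure μ] [IsFiniteMeasure ν] : ENNReal :=
  (μ.toSignedMeasure - ν.toSignedMeasure).totalVariation Set.univ

/-- A map `m` from `X` to the Radon probability measures on `G`, continuous for the weak-*
topology (that of the pairing with `C₀(G)`). -/
structure IsContinuousProbMap {X G : Type*} [TopologicalSpace X] [TopologicalSpace G]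
    [MeasurableSpace G] (m : X → Measure G) : Prop where
  isProbabilityMeasure : ∀ x, IsProbabilityMeasure (m x)
  regular : ∀ x, (m x).Regular
  continuous_integral : ∀ f : C₀(G, ℝ), Continuous fun x => ∫ t, f t ∂(m x)

/-- Amenability of an action of `G` on `X`: there is a net of weak-* continuous maps
`x ↦ mᵢˣ` from `X` to the Radon probability measures on `G` such that `‖s • mᵢˣ - mᵢ^{s x}‖₁ → 0`
uniformly on compact subsets of `X × G`. The existence of the net is spelled out as: for every
compact set and every `ε > 0` there is such a map with norm at most `ε` on the compact set. -/
def IsAmenableAction (G X : Type*) [Group G] [TopologicalSpace G] [IsTopologicalGroup G]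
    [MeasurableSpace G] [BorelSpace G] [TopologicalSpace X] [MulAction G X] : Prop :=
  ∀ C : Set (X × G), IsCompact C → ∀ ε : ℝ, 0 < ε →
    ∃ (m : X → Measure G) (hm : IsContinuousProbMap m),
      ∀ p ∈ C,
        haveI := hm.isProbabilityMeasure
        tvDist ((m p.1).map fun t => p.2 * t) (m (p.2 • p.1)) ≤ ENNReal.ofReal ε

/-- `G` is amenable at infinity: it admits an amenable continuous action on some (non-empty)
compact Hausdorff space. -/
def IsAmenableAtInfinity (G : Type u) [Group G] [TopologicalSpace G] [IsTopologicalGroup G]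
    [MeasurableSpace G] [BorelSpace G] : Prop :=
  ∃ (X : Type u) (_ : TopologicalSpace X) (_ : MulAction G X),
    Nonempty X ∧ CompactSpace X ∧ T2Space X ∧ ContinuousSMul G X ∧ IsAmenableAction G X

/-- The representation of `G` on `C_b(X)`: `(g f)(x) = f (g⁻¹ x)`. -/
noncomputable def cbTranslate {G X : Type*} [Group G] [TopologicalSpace G] [TopologicalSpace X]
    [MulAction G X] [ContinuousSMul G X] (g : G) (f : X →ᵇ ℝ) : X →ᵇ ℝ :=
  f.compContinuous ⟨fun x => g⁻¹ • x, continuous_const_smul g⁻¹⟩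

/-- The `G`-representation on `C_b(X)` is continuous for the sup-norm. -/
def IsNormContinuousOnCb (G X : Type*) [Group G] [TopologicalSpace G] [TopologicalSpace X]
    [MulAction G X] [ContinuousSMul G X] : Prop :=
  Continuous fun p : G × (X →ᵇ ℝ) => cbTranslate p.1 p.2

/-! For (i) ⇒ (ii), a compact `X` is itself a witness of amenability at infinity, so let `X` be
non-compact. Norm continuity on C_b(X) is so restrictive that a whole neighbourhood of 1 acts
trivially off one compact set (`IsNormContinuousOnCb.exists_isCompact_fixed_mem_nhds`); otherwise,
along points escaping to infinity, Urysohn's lemma yields a function whose orbit map is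
discontinuous. Hence the elements acting trivially off some compact set form an open normal
subgroup. Finitely many of them always share a fixed point x, and almost equivariance of the
measures at x becomes almost invariance; averaging an orbit map into a convex compact space against
them gives a fixed point, so this subgroup is amenable
(`IsAmenableAction.isAmenableGroup_of_finite_fixed`).

For (ii) ⇒ (i), a compact space works at once. If `A` is amenable, open and normal, use the discrete
space `G ⧸ A`: `A` acts trivially on it, which gives norm continuity, and Reiter measures on `A`,
transported to the cosets by a section, make the action amenable. Reiter's condition is derived from
the fixed point property by Hahn–Banach separation in L¹. -/

/-! ### From the fixed point property to Reiter's condition -/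

/-- If an amenable group acts isometrically on a normed space and `0` is not in the closed convex
hull of the orbit of `u`, then some invariant functional does not vanish at `u`. -/
theorem IsAmenableGroup.exists_invariant_functional {G : Type u} [Group G] [TopologicalSpace G]
    [IsTopologicalGroup G] (hG : IsAmenableGroup G) {B : Type u} [NormedAddCommGroup B]
    [NormedSpace ℝ B] (π : G →* (B →L[ℝ] B)) (hπ : ∀ g x, ‖π g x‖ ≤ ‖x‖)
    (hc : ∀ x, Continuous fun g => π g x) (u : B)
    (hu : (0 : B) ∉ closure (convexHull ℝ (Set.range fun g => π g u))) :
    ∃ l : B →L[ℝ] ℝ, (∀ g x, l (π g x) = l x) ∧ l u ≠ 0 := by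
  obtain ⟨f, c, hf0, hfc⟩ := geometric_hahn_banach_point_closed
    (convex_convexHull ℝ _).closure isClosed_closure hu
  have hc0 : 0 < c := by simpa using hf0
  have hfu : ∀ g, c ≤ f (π g u) := fun g =>
    (hfc _ (subset_closure (subset_convexHull ℝ _ ⟨g, rfl⟩))).le
  have hbound : ∀ l : WeakDual ℝ B, ∀ g : G,
      ‖((WeakDual.toStrongDual l).comp (π g) : B →L[ℝ] ℝ)‖ ≤ ‖WeakDual.toStrongDual l‖ :=
    fun l g => ContinuousLinearMap.opNorm_le_bound _ (norm_nonneg _) fun x =>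
      ((WeakDual.toStrongDual l).le_opNorm _).trans
        (mul_le_mul_of_nonneg_left (hπ g x) (norm_nonneg _))
  -- A fixed point in `K` is an invariant functional. The norm bound gives weak-* compactness, and
  -- the bound below by `c > 0` along the whole orbit is an invariant condition that prevents
  -- vanishing at `u`.
  let K : Set (WeakDual ℝ B) :=
    (WeakDual.toStrongDual ⁻¹' Metric.closedBall 0 ‖f‖) ∩ {l | ∀ g, c ≤ l (π g u)}
  have hKcomp : IsCompact K := by
    refine (WeakDual.isCompact_closedBall (𝕜 := ℝ) (E := B) 0 ‖f‖).inter_right ?_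
    simp only [Set.ofPred_forall]
    exact isClosed_iInter fun g => isClosed_le continuous_const (WeakDual.eval_continuous _)
  have hKconv : Convex ℝ K := by
    refine Convex.inter ((convex_closedBall _ _).is_linear_preimage ?_) ?_
    · exact (WeakDual.toStrongDual (𝕜 := ℝ) (E := B)).toLinearMap.isLinear
    · intro x hx y hy a b ha hb hab g
      have h1 := mul_le_mul_of_nonneg_left (hx g) ha
      have h2 := mul_le_mul_of_nonneg_left (hy g) hb
      change c ≤ a * x (π g u) + b * y (π g u)
      calc c = a * c + b * c := by rw [← add_mul, hab, one_mul]
        _ ≤ _ := add_le_add h1 h2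
  have hKne : K.Nonempty := ⟨StrongDual.toWeakDual f, by simp [K]; exact hfu⟩
  let act : G → K → K := fun g l =>
    ⟨StrongDual.toWeakDual ((WeakDual.toStrongDual l.1).comp (π g⁻¹)), by
      refine ⟨?_, fun h => ?_⟩
      · have := l.2.1
        simp only [Set.mem_preimage, mem_closedBall_zero_iff] at this ⊢
        exact (hbound l.1 g⁻¹).trans this
      · have := l.2.2 (g⁻¹ * h)
        rwa [map_mul] at this⟩
  have hact : ∀ g l x, (act g l).1 x = l.1 (π g⁻¹ x) := fun _ _ _ => rfl
  let _ : MulAction G K :=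
    { smul := act
      one_smul := fun l => by
        apply Subtype.ext; apply DFunLike.ext; intro x
        change (act 1 l).1 x = _
        simp [hact]
      mul_smul := fun g h l => by
        apply Subtype.ext; apply DFunLike.ext; intro x
        change (act (g * h) l).1 x = (act g (act h l)).1 x
        simp [hact] }
  have hsm : ∀ (g : G) (l : K) x, (g • l : K).1 x = l.1 (π g⁻¹ x) := fun _ _ _ => rfl
  have _ : ContinuousSMul G K := by
    refine ⟨Continuous.subtype_mk (WeakDual.continuous_of_continuous_eval fun x => ?_) _⟩
    change Continuous fun p : G × K => (p.2 : WeakDual ℝ B) (π p.1⁻¹ x)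
    rw [continuous_iff_continuousAt]
    rintro ⟨g, l⟩
    -- Joint continuity: the functionals in `K` are uniformly bounded by `‖f‖`, so the variation of
    -- the vector is controlled in norm and that of the functional only at a fixed vector.
    have h1 : Filter.Tendsto (fun p : G × K => ‖f‖ * ‖π p.1⁻¹ x - π g⁻¹ x‖) (nhds (g, l))
        (nhds 0) := by
      have : Continuous fun p : G × K => ‖f‖ * ‖π p.1⁻¹ x - π g⁻¹ x‖ :=
        continuous_const.mul
          ((((hc x).comp continuous_inv).comp continuous_fst).sub continuous_const).norm
      simpa using this.tendsto (g, l)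
    have h2 : Filter.Tendsto (fun p : G × K => (p.2 : WeakDual ℝ B) (π p.1⁻¹ x - π g⁻¹ x))
        (nhds (g, l)) (nhds 0) := by
      refine squeeze_zero_norm (fun p => ?_) h1
      have hp := p.2.2.1
      simp only [Set.mem_preimage, mem_closedBall_zero_iff] at hp
      exact ((WeakDual.toStrongDual p.2.1).le_opNorm _).trans
        (mul_le_mul_of_nonneg_right hp (norm_nonneg _))
    have h3 : Filter.Tendsto (fun p : G × K => (p.2 : WeakDual ℝ B) (π g⁻¹ x))
        (nhds (g, l)) (nhds ((l : WeakDual ℝ B) (π g⁻¹ x))) :=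
      ((WeakDual.eval_continuous (π g⁻¹ x)).comp
        (continuous_subtype_val.comp continuous_snd)).tendsto (g, l)
    have h4 := h2.add h3
    rw [zero_add] at h4
    refine h4.congr fun p => ?_
    rw [← map_add, sub_add_cancel]
  have _ : LocallyConvexSpace ℝ (WeakDual ℝ B) :=
    inferInstanceAs (LocallyConvexSpace ℝ (WeakBilin (topDualPairing ℝ B)))
  obtain ⟨l, hl⟩ := hG (WeakDual ℝ B) K hKcomp hKconv hKne (by
    intro g x y z a b _ _ _ hz
    apply DFunLike.ext; intro v
    rw [hsm, hz]
    change a * x.1 (π g⁻¹ v) + b * y.1 (π g⁻¹ v) = a * (g • x : K).1 v + b * (g • y : K).1 v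
    rw [hsm, hsm])
  refine ⟨WeakDual.toStrongDual l.1, fun g x => ?_, ?_⟩
  · have := hsm g⁻¹ l x
    rw [hl, inv_inv] at this
    exact this.symm
  · have := l.2.2 1
    rw [map_one] at this
    exact (hc0.trans_le this).ne'

section RightTranslation

variable {H : Type u} [Group H] [TopologicalSpace H] [IsTopologicalGroup H]
  [MeasurableSpace H] [BorelSpace H]

/-- The isometric action of a group on `L¹` of a right invariant measure by right translations. -/
noncomputable def rightTranslationL1 (ρ : Measure H) [ρ.IsMulRightInvariant] :
    H →* (Lp ℝ 1 ρ →L[ℝ] Lp ℝ 1 ρ) where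
  toFun h := (DistribSMul.toLinearMap ℝ (Lp ℝ 1 ρ)
    (DomMulAct.mk (MulOpposite.op h))).mkContinuous 1 fun x => by
      rw [one_mul]; exact (DomMulAct.norm_smul_Lp _ x).le
  map_one' := by
    ext1 x
    exact one_smul (Hᵐᵒᵖ)ᵈᵐᵃ x
  map_mul' g h := by
    ext1 x
    exact mul_smul (DomMulAct.mk (MulOpposite.op g)) (DomMulAct.mk (MulOpposite.op h)) x

variable (ρ : Measure H) [ρ.IsMulRightInvariant]

theorem norm_rightTranslationL1 (h : H) (x : Lp ℝ 1 ρ) : ‖rightTranslationL1 ρ h x‖ = ‖x‖ :=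
  DomMulAct.norm_smul_Lp _ x

theorem continuous_rightTranslationL1 [LocallyCompactSpace H] [ρ.Regular] (x : Lp ℝ 1 ρ) :
    Continuous fun h => rightTranslationL1 ρ h x := by
  have : Fact ((1 : ENNReal) ≠ ⊤) := ⟨ENNReal.one_ne_top⟩
  borelize Hᵐᵒᵖ
  have hc : Continuous fun h : H => DomMulAct.mk (MulOpposite.op h) := by
    fun_prop
  exact hc.smul continuous_const

/-- A bounded functional on `L¹` of a right invariant measure which is invariant under
right translations is proportional to the integral. -/
theorem exists_eq_smul_integral_of_rightTranslation_invariant [LocallyCompactSpace H] [T2Space H]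
    [ρ.Regular] [ρ.IsOpenPosMeasure]
    (l : Lp ℝ 1 ρ →L[ℝ] ℝ) (hl : ∀ h x, l (rightTranslationL1 ρ h x) = l x) :
    ∃ c : ℝ, ∀ (f : H → ℝ) (hf : Integrable f ρ), Continuous f → HasCompactSupport f →
      l (hf.toL1 f) = c * ∫ t, f t ∂ρ := by
  have hint : ∀ f : CompactlySupportedContinuousMap H ℝ, Integrable f ρ := fun f =>
    f.continuous.integrable_of_hasCompactSupport f.hasCompactSupport
  -- Since |l(f)| ≤ ‖l‖ ∫ f for f ≥ 0, adding `‖l‖` times the integral makes `l` positive, and the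
  -- Riesz representation applies.
  let Λ₀ : CompactlySupportedContinuousMap H ℝ →ₗ[ℝ] ℝ :=
    { toFun := fun f => l ((hint f).toL1 f) + ‖l‖ * ∫ t, f t ∂ρ
      map_add' := fun f g => by
        have : (hint (f + g)).toL1 (f + g : CompactlySupportedContinuousMap H ℝ)
            = (hint f).toL1 f + (hint g).toL1 g := Integrable.toL1_add _ _ _ _
        rw [this, map_add]
        simp only [CompactlySupportedContinuousMap.coe_add, Pi.add_apply]
        rw [integral_add (hint f) (hint g)]
        ring
      map_smul' := fun c f => by
        have : (hint (c • f)).toL1 (c • f : CompactlySupportedContinuousMap H ℝ)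
            = c • (hint f).toL1 f := Integrable.toL1_smul f (hint f) c
        rw [this, map_smul]
        simp only [CompactlySupportedContinuousMap.coe_smul, Pi.smul_apply]
        rw [integral_smul]
        simp only [smul_eq_mul, RingHom.id_apply]
        ring }
  let Λ : CompactlySupportedContinuousMap H ℝ →ₚ[ℝ] ℝ := PositiveLinearMap.mk₀ Λ₀ fun f hf => by
    change 0 ≤ l ((hint f).toL1 f) + ‖l‖ * ∫ t, f t ∂ρ
    have h1 := l.le_opNorm ((hint f).toL1 f)
    rw [L1.norm_of_fun_eq_integral_norm] at h1
    have h2 : ∫ t, ‖f t‖ ∂ρ = ∫ t, f t ∂ρ :=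
      integral_congr_ae (Filter.Eventually.of_forall fun t => Real.norm_of_nonneg (hf t))
    rw [h2] at h1
    have := neg_abs_le (l ((hint f).toL1 f))
    rw [← Real.norm_eq_abs] at this
    linarith
  have hΛ : ∀ f, Λ f = l ((hint f).toL1 f) + ‖l‖ * ∫ t, f t ∂ρ := fun _ => rfl
  let ν := RealRMK.rieszMeasure Λ
  have hν : ∀ f : CompactlySupportedContinuousMap H ℝ, ∫ t, f t ∂ν = Λ f :=
    RealRMK.integral_rieszMeasure Λ
  have hνinv : ν.IsMulRightInvariant := by
    refine ⟨fun h => ?_⟩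
    have : (ν.map (· * h)).Regular := Measure.Regular.map (Homeomorph.mulRight h)
    refine Measure.ext_of_integral_eq_on_compactlySupported fun f => ?_
    rw [integral_map (by fun_prop) (by fun_prop)]
    let f' : CompactlySupportedContinuousMap H ℝ :=
      ⟨⟨fun t => f (t * h), by fun_prop⟩,
        f.hasCompactSupport.comp_homeomorph (Homeomorph.mulRight h)⟩
    change ∫ t, f' t ∂ν = _
    rw [hν, hν, hΛ, hΛ]
    have h1 : (hint f').toL1 f' = rightTranslationL1 ρ h ((hint f).toL1 f) := rfl
    rw [h1, hl]
    congr 2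
    exact integral_mul_right_eq_self (fun t => f t) h
  -- Inversion turns right invariance into left invariance, so that uniqueness of Haar measure
  -- compares `ν.inv` with `ρ.inv`.
  have hρH : (ρ.inv).IsHaarMeasure := {}
  refine ⟨Measure.haarScalarFactor ν.inv ρ.inv - ‖l‖, fun f hf hfc hfs => ?_⟩
  let f₀ : CompactlySupportedContinuousMap H ℝ := ⟨⟨f, hfc⟩, hfs⟩
  have h1 := hν f₀
  rw [hΛ] at h1
  have h2 := Measure.integral_isMulLeftInvariant_eq_smul_of_hasCompactSupport ν.inv ρ.inv
    (f := fun t => f t⁻¹) (by fun_prop) (hfs.comp_homeomorph (Homeomorph.inv H))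
  have h3 : ∀ μ : Measure H, ∫ t, f t⁻¹ ∂μ.inv = ∫ t, f t ∂μ := fun μ => by
    have := integral_map (μ := μ) (φ := Inv.inv) (f := fun t => f t⁻¹)
      measurable_inv.aemeasurable (hfc.comp continuous_inv).aestronglyMeasurable
    rw [Measure.inv, this]
    simp
  rw [integral_smul_nnreal_measure, h3, h3] at h2
  change ∫ t, f t ∂ν = l (hf.toL1 f) + ‖l‖ * ∫ t, f t ∂ρ at h1
  rw [h2, NNReal.smul_def, smul_eq_mul] at h1
  linarith

end RightTranslation

theorem MeasureTheory.Integrable.toL1_finset_sum {α κ : Type*} [MeasurableSpace α] {μ : Measure α}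
    (s : Finset κ) (w : κ → ℝ) (f : κ → α → ℝ) (hf : ∀ i, Integrable (f i) μ)
    (hs : Integrable (fun t => ∑ i ∈ s, w i * f i t) μ) :
    hs.toL1 (fun t => ∑ i ∈ s, w i * f i t) = ∑ i ∈ s, w i • (hf i).toL1 (f i) := by
  classical
  induction s using Finset.induction_on with
  | empty => simp [← Integrable.toL1_zero (integrable_zero α ℝ μ), Pi.zero_def]
  | insert i s hi ih =>
    have h1 : Integrable (fun t => ∑ i ∈ s, w i * f i t) μ :=
      integrable_finsetSum _ fun i _ => (hf i).const_mul _
    rw [Finset.sum_insert hi, ← ih h1, ← Integrable.toL1_smul, ← Integrable.toL1_add]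
    congr 1
    ext t
    simp [Finset.sum_insert hi]

/-- A finite measure with a continuous compactly supported density is regular. -/
theorem regular_withDensity_of_hasCompactSupport {X : Type*} [TopologicalSpace X] [T2Space X]
    [MeasurableSpace X] [BorelSpace X] (ρ : Measure X) [ρ.Regular] {θ : X → ℝ}
    (hθ : Continuous θ) (hs : HasCompactSupport θ) :
    (ρ.withDensity fun t => ENNReal.ofReal (θ t)).Regular := by
  have hint : Integrable θ ρ := hθ.integrable_of_hasCompactSupport hs
  have hfin : ∫⁻ t, ENNReal.ofReal (θ t) ∂ρ ≠ ⊤ := hint.lintegral_lt_top.ne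
  have : IsFiniteMeasure (ρ.withDensity fun t => ENNReal.ofReal (θ t)) :=
    isFiniteMeasure_withDensity hfin
  set ν := ρ.withDensity fun t => ENNReal.ofReal (θ t) with hν
  let T := tsupport θ
  have hTc : IsCompact T := hs
  have hTm : MeasurableSet T := (isClosed_tsupport θ).measurableSet
  have hνT : ν Tᶜ = 0 := by
    rw [hν, withDensity_apply _ hTm.compl]
    refine setLIntegral_eq_zero hTm.compl fun t ht => ?_
    simp [image_eq_zero_of_notMem_tsupport ht]
  have : ν.InnerRegularCompactLTTop := by
    refine ⟨fun s hs r hr => ?_⟩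
    have hpos : ν s - r ≠ 0 := (tsub_pos_of_lt hr).ne'
    -- Absolute continuity of the integral converts inner regularity of `ρ` on `s ∩ T` into inner
    -- regularity of `ν`.
    obtain ⟨δ, hδ, hδs⟩ := exists_pos_setLIntegral_lt_of_measure_lt hfin hpos
    have hsT : MeasurableSet (s ∩ T) := hs.1.inter hTm
    have hρsT : ρ (s ∩ T) ≠ ⊤ :=
      ((measure_mono Set.inter_subset_right).trans_lt hTc.measure_lt_top).ne
    obtain ⟨K, hKs, hK, hKδ⟩ := hsT.exists_isCompact_sdiff_lt hρsT hδ.ne'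
    refine ⟨K, hKs.trans Set.inter_subset_left, hK, ?_⟩
    have h1 : ν ((s ∩ T) \ K) < ν s - r := by
      have := hδs _ hKδ
      rwa [← withDensity_apply _ (hsT.diff hK.measurableSet)] at this
    by_contra! hle
    have h2 : ν s ≤ ν K + ν ((s ∩ T) \ K) :=
      calc ν s ≤ ν (s ∩ T) + ν (s ∩ Tᶜ) := measure_le_inter_add_sdiff ν s T
        _ ≤ ν (s ∩ T) + 0 := by
          gcongr; exact (measure_mono Set.inter_subset_right).trans hνT.le
        _ = ν (s ∩ T) := add_zero _
        _ ≤ ν (K ∪ ((s ∩ T) \ K)) := measure_mono (by simp)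
        _ ≤ _ := measure_union_le _ _
    have h3 : ν K + ν ((s ∩ T) \ K) < r + (ν s - r) :=
      ENNReal.add_lt_add_of_le_of_lt (measure_ne_top _ _) hle h1
    rw [add_tsub_cancel_of_le hr.le] at h3
    exact (h2.trans_lt h3).false
  infer_instance

section LeftFactor

variable {H : Type*} [Group H] [TopologicalSpace H] [IsTopologicalGroup H]
  [LocallyCompactSpace H] [MeasurableSpace H] [BorelSpace H]

/-- The factor is a value of the modular function: inverted Haar measure is right invariant, and
left translations only rescale it. -/
theorem exists_left_translation_factor (a : H) :
    ∃ c : ℝ, 0 < c ∧ ∀ f : H → ℝ,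
      c * ∫ t, f (a⁻¹ * t) ∂(Measure.haar : Measure H).inv
        = ∫ t, f t ∂(Measure.haar : Measure H).inv := by
  have hc := Measure.haarScalarFactor_pos_of_isHaarMeasure
    ((Measure.haar : Measure H).map (· * a)) Measure.haar
  set d := Measure.haarScalarFactor ((Measure.haar : Measure H).map (· * a)) Measure.haar with hd
  have hreg : ((Measure.haar : Measure H).map (· * a)).Regular :=
    Measure.Regular.map (Homeomorph.mulRight a)
  have h1 : (Measure.haar : Measure H).map (· * a) = d • Measure.haar :=
    Measure.isMulLeftInvariant_eq_smul_of_regular _ _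
  refine ⟨(d : ℝ)⁻¹, by positivity, fun f => ?_⟩
  have h2 : ∀ g : H → ℝ, ∫ t, g t ∂(Measure.haar : Measure H).inv
      = ∫ t, g t⁻¹ ∂(Measure.haar : Measure H) := fun g =>
    (Homeomorph.inv H).measurableEmbedding.integral_map g
  have h3 := (Homeomorph.mulRight a).measurableEmbedding.integral_map
    (μ := (Measure.haar : Measure H)) (fun t => f t⁻¹)
  change ∫ t, f t⁻¹ ∂((Measure.haar : Measure H).map (· * a))
    = ∫ t, f (t * a)⁻¹ ∂(Measure.haar : Measure H) at h3
  rw [h1, integral_smul_nnreal_measure, NNReal.smul_def, smul_eq_mul] at h3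
  rw [h2, h2]
  simp only [mul_inv_rev] at h3
  rw [← h3, inv_mul_cancel_left₀ (by positivity)]

end LeftFactor

/-- If 0 were not in the closed convex hull of the orbit of the tuple (ψᵢ − φ)ᵢ in a power of L¹, an
invariant functional would be nonzero on the tuple. But each of its coordinates is a multiple of the
integral on compactly supported continuous functions, and the ψᵢ − φ have integral 0. Treating the
tuple as one vector yields weights common to all `i`. -/
theorem IsAmenableGroup.exists_almost_invariant_density {H : Type u} [Group H] [TopologicalSpace H]
    [IsTopologicalGroup H] [LocallyCompactSpace H] [T2Space H] [MeasurableSpace H] [BorelSpace H]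
    (hH : IsAmenableGroup H) (ρ : Measure H) [ρ.IsMulRightInvariant] [ρ.Regular]
    [ρ.IsOpenPosMeasure] {κ : Type u} [Fintype κ] {φ : H → ℝ} (hφ : Continuous φ)
    (hφs : HasCompactSupport φ) (ψ : κ → H → ℝ) (hψ : ∀ i, Continuous (ψ i))
    (hψs : ∀ i, HasCompactSupport (ψ i)) (hψφ : ∀ i, ∫ t, ψ i t ∂ρ = ∫ t, φ t ∂ρ)
    {ε : ℝ} (hε : 0 < ε) :
    ∃ (n : Type) (_ : Fintype n) (w : n → ℝ) (h : n → H), (∀ j, 0 ≤ w j) ∧ ∑ j, w j = 1 ∧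
      ∀ i, ∫ t, |∑ j, w j * (ψ i (t * h j) - φ (t * h j))| ∂ρ ≤ ε := by
  classical
  have hd : ∀ i, Continuous (ψ i - φ) := fun i => (hψ i).sub hφ
  have hds : ∀ i, HasCompactSupport (ψ i - φ) := fun i => (hψs i).sub hφs
  have hint : ∀ i, Integrable (ψ i - φ) ρ := fun i =>
    (hd i).integrable_of_hasCompactSupport (hds i)
  let u : κ → Lp ℝ 1 ρ := fun i => (hint i).toL1 (ψ i - φ)
  let π : H →* ((κ → Lp ℝ 1 ρ) →L[ℝ] (κ → Lp ℝ 1 ρ)) :=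
    { toFun := fun h => ContinuousLinearMap.pi fun i =>
        (rightTranslationL1 ρ h).comp (ContinuousLinearMap.proj i)
      map_one' := by ext1 x; funext i; simp
      map_mul' := fun g h => by ext1 x; funext i; simp }
  have hπ : ∀ h x i, π h x i = rightTranslationL1 ρ h (x i) := fun _ _ _ => rfl
  have h0 : (0 : κ → Lp ℝ 1 ρ) ∈ closure (convexHull ℝ (Set.range fun g => π g u)) := by
    by_contra hcon
    obtain ⟨l, hl, hlu⟩ := hH.exists_invariant_functional π
      (fun g x => (pi_norm_le_iff_of_nonneg (norm_nonneg _)).2 fun i => by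
        rw [hπ, norm_rightTranslationL1]; exact norm_le_pi_norm x i)
      (fun x => continuous_pi fun i => continuous_rightTranslationL1 ρ (x i)) u hcon
    refine hlu ?_
    have hsum : u = ∑ i, Pi.single i (u i) := (Finset.univ_sum_single u).symm
    rw [hsum, map_sum]
    refine Finset.sum_eq_zero fun i _ => ?_
    let li : Lp ℝ 1 ρ →L[ℝ] ℝ := l.comp (ContinuousLinearMap.single ℝ (fun _ => Lp ℝ 1 ρ) i)
    obtain ⟨c, hc⟩ := exists_eq_smul_integral_of_rightTranslation_invariant ρ li fun h x => by
      change l (Pi.single i _) = l (Pi.single i x)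
      rw [← hl h (Pi.single i x)]
      congr 1
      funext j
      rw [hπ]
      by_cases hj : j = i
      · subst hj; simp
      · simp [Pi.single_eq_of_ne hj]
    change li (u i) = 0
    rw [hc _ (hint i) (hd i) (hds i)]
    simp only [Pi.sub_apply]
    rw [integral_sub ((hψ i).integrable_of_hasCompactSupport (hψs i))
      (hφ.integrable_of_hasCompactSupport hφs), hψφ i, sub_self, mul_zero]
  obtain ⟨v, hv, hvε⟩ := Metric.mem_closure_iff.1 h0 ε hε
  rw [dist_zero_left] at hvε
  obtain ⟨n, _, w, z, hw, hw1, hz, hzv⟩ := mem_convexHull_iff_exists_fintype.1 hv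
  choose h hh using hz
  refine ⟨n, inferInstance, w, h, hw, hw1, fun i => ?_⟩
  have hint' : ∀ j, Integrable (fun t => (ψ i - φ) (t * h j)) ρ := fun j =>
    (hint i).comp_mul_right (h j)
  have hvi : v i = (integrable_finsetSum Finset.univ fun j _ => (hint' j).const_mul (w j)).toL1
      (fun t => ∑ j, w j * (ψ i - φ) (t * h j)) := by
    rw [Integrable.toL1_finset_sum _ _ _ hint', ← hzv, Finset.sum_apply]
    refine Finset.sum_congr rfl fun j _ => ?_
    rw [← hh j]
    rfl
  have hle := (norm_le_pi_norm v i).trans hvε.le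
  rw [hvi, L1.norm_of_fun_eq_integral_norm] at hle
  exact hle

/-- Continuity of the integral of `g a` when the supports are contained in `a • T`. -/
theorem continuous_integral_of_left_translated_support {H : Type*} [Group H] [TopologicalSpace H]
    [IsTopologicalGroup H] [LocallyCompactSpace H] [MeasurableSpace H] [BorelSpace H]
    (ρ : Measure H) [IsFiniteMeasureOnCompacts ρ] {T : Set H} (hT : IsCompact T)
    {g : H → H → ℝ} (hg : Continuous g.uncurry) (hgT : ∀ a t, a⁻¹ * t ∉ T → g a t = 0) :
    Continuous fun a => ∫ t, g a t ∂ρ := by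
  rw [continuous_iff_continuousAt]
  intro a
  obtain ⟨N, hN, hNa⟩ := exists_compact_mem_nhds a
  refine (continuousOn_integral_of_compact_support (hN.mul hT) hg.continuousOn
    fun b t hb ht => hgT b t fun hbt => ht ?_).continuousAt hNa
  exact ⟨b, hb, b⁻¹ * t, hbt, by simp⟩

theorem exists_continuous_hasCompactSupport_integral_eq_one {X : Type*} [TopologicalSpace X]
    [RegularSpace X] [LocallyCompactSpace X] [Nonempty X] [MeasurableSpace X] [BorelSpace X]
    (ρ : Measure X) [IsFiniteMeasureOnCompacts ρ] [ρ.IsOpenPosMeasure] :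
    ∃ φ : X → ℝ, Continuous φ ∧ HasCompactSupport φ ∧ (∀ t, 0 ≤ φ t) ∧ ∫ t, φ t ∂ρ = 1 := by
  obtain ⟨f, hf, hf0, hf1⟩ := exists_continuous_nonneg_pos (Classical.arbitrary X)
  have hpos : 0 < ∫ t, f t ∂ρ :=
    f.continuous.integral_pos_of_hasCompactSupport_nonneg_nonzero hf hf0 hf1
  refine ⟨fun t => (∫ t, f t ∂ρ)⁻¹ * f t, by fun_prop, hf.mul_left,
    fun t => mul_nonneg (inv_nonneg.2 hpos.le) (hf0 t), ?_⟩
  rw [integral_const_mul, inv_mul_cancel₀ hpos.ne']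

/-- **Reiter's condition**: an amenable locally compact group carries regular probability measures
that are almost invariant, uniformly on compact sets of translations. -/
theorem IsAmenableGroup.exists_almost_invariant_measure {H : Type u} [Group H] [TopologicalSpace H]
    [IsTopologicalGroup H] [LocallyCompactSpace H] [T2Space H] [MeasurableSpace H] [BorelSpace H]
    (hH : IsAmenableGroup H) {Q : Set H} (hQ : IsCompact Q) {ε : ℝ} (hε : 0 < ε) :
    ∃ μ : Measure H, IsProbabilityMeasure μ ∧ μ.Regular ∧
      ∀ a ∈ Q, ∀ s, MeasurableSet s → |(μ.map (a * ·)).real s - μ.real s| ≤ ε := by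
  classical
  obtain ⟨ρ, hρ⟩ : ∃ ρ : Measure H, ρ = (Measure.haar : Measure H).inv := ⟨_, rfl⟩
  have _ : ρ.IsMulRightInvariant := by rw [hρ]; infer_instance
  have _ : ρ.Regular := by rw [hρ]; infer_instance
  have _ : ρ.IsOpenPosMeasure := by rw [hρ]; infer_instance
  have hfac : ∀ a : H, ∃ c : ℝ, 0 < c ∧ ∀ f : H → ℝ, c * ∫ t, f (a⁻¹ * t) ∂ρ = ∫ t, f t ∂ρ := by
    rw [hρ]; exact exists_left_translation_factor
  choose c hc0 hc using hfac
  obtain ⟨φ, hφ, hφs, hφ0, hφ1⟩ := exists_continuous_hasCompactSupport_integral_eq_one ρ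
  have hT : ∀ a t, a⁻¹ * t ∉ tsupport φ → φ (a⁻¹ * t) = 0 := fun a t h =>
    image_eq_zero_of_notMem_tsupport h
  have hccont : Continuous c := by
    have h1 : ∀ a, c a = (∫ t, φ (a⁻¹ * t) ∂ρ)⁻¹ := fun a => by
      have := hc a φ
      rw [hφ1] at this
      exact eq_inv_of_mul_eq_one_left this
    rw [funext h1]
    refine (continuous_integral_of_left_translated_support ρ hφs
      (g := fun a t => φ (a⁻¹ * t)) (by fun_prop) hT).inv₀ fun a h => ?_
    have := hc a φ
    rw [h, hφ1] at this
    simp at this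
  -- The left translate of `φ` by `a`, normalised to keep integral 1. Right averaging commutes with
  -- left translation, so making all `ψ a - φ` small on average makes the averaged density `θ`
  -- almost left invariant.
  let ψ : H → H → ℝ := fun a t => c a * φ (a⁻¹ * t)
  have hψc : Continuous ψ.uncurry :=
    (hccont.comp continuous_fst).mul (hφ.comp (continuous_fst.inv.mul continuous_snd))
  have hψ : ∀ a, Continuous (ψ a) := fun a => by fun_prop
  have hψs : ∀ a, HasCompactSupport (ψ a) := fun a =>
    (hφs.comp_homeomorph (Homeomorph.mulLeft a⁻¹)).mul_left
  have hψi : ∀ a, Integrable (ψ a) ρ := fun a => (hψ a).integrable_of_hasCompactSupport (hψs a)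
  have hφi : Integrable φ ρ := hφ.integrable_of_hasCompactSupport hφs
  have hψ1 : ∀ a, ∫ t, ψ a t ∂ρ = ∫ t, φ t ∂ρ := fun a => by
    simp only [ψ]
    rw [integral_const_mul, hc]
  have hnear : ∀ b, {a | ∫ t, |ψ a t - ψ b t| ∂ρ < ε / 2} ∈ nhds b := by
    intro b
    obtain ⟨N, hN, hNb⟩ := exists_compact_mem_nhds b
    have hcon : ContinuousOn (fun a => ∫ t, |ψ a t - ψ b t| ∂ρ) N := by
      refine continuousOn_integral_of_compact_support (hN.mul hφs) ?_ fun a t ha ht => ?_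
      · exact (hψc.sub ((hψ b).comp continuous_snd)).abs.continuousOn
      · have h1 : ∀ a ∈ N, ψ a t = 0 := fun a ha => by
          simp only [ψ]
          rw [hT a t fun h => ht ⟨a, ha, a⁻¹ * t, h, by simp⟩, mul_zero]
        rw [h1 a ha, h1 b (mem_of_mem_nhds hNb)]
        simp
    refine (hcon.continuousAt hNb).eventually_lt_const ?_
    simpa using half_pos hε
  obtain ⟨F, -, hF⟩ := hQ.elim_nhds_subcover _ fun b _ => hnear b
  obtain ⟨n, _, w, h, hw, hw1, hwh⟩ := hH.exists_almost_invariant_density ρ hφ hφs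
    (fun b : F => ψ b) (fun b => hψ b) (fun b => hψs b) (fun b => hψ1 b) (half_pos hε)
  let θ : H → ℝ := fun t => ∑ j, w j * φ (t * h j)
  have hθ : Continuous θ := by fun_prop
  have hθs : HasCompactSupport θ := by
    refine HasCompactSupport.intro (K := ⋃ j, (fun t => t * h j) ⁻¹' tsupport φ)
      (isCompact_iUnion fun j => ?_) fun t ht => Finset.sum_eq_zero fun j _ => ?_
    · exact (Homeomorph.mulRight (h j)).isCompact_preimage.2 hφs
    · rw [image_eq_zero_of_notMem_tsupport (f := φ) fun h' => ht (Set.mem_iUnion.2 ⟨j, h'⟩), mul_zero]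
  have hθi : Integrable θ ρ := hθ.integrable_of_hasCompactSupport hθs
  have hθ0 : ∀ t, 0 ≤ θ t := fun t => Finset.sum_nonneg fun j _ => mul_nonneg (hw j) (hφ0 _)
  have hθ1 : ∫ t, θ t ∂ρ = 1 := by
    simp only [θ]
    rw [integral_finsetSum _ fun j _ => (hφi.comp_mul_right (h j)).const_mul (w j)]
    simp_rw [integral_const_mul, integral_mul_right_eq_self (μ := ρ) φ, hφ1, mul_one, hw1]
  obtain ⟨μ, hμ⟩ : ∃ μ : Measure H, μ = ρ.withDensity fun t => ENNReal.ofReal (θ t) := ⟨_, rfl⟩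
  have hμs : ∀ s, MeasurableSet s → μ.real s = ∫ t in s, θ t ∂ρ := fun s hs => by
    rw [hμ, measureReal_def, withDensity_apply _ hs,
      integral_eq_lintegral_of_nonneg_ae (Filter.Eventually.of_forall hθ0)
        hθ.aestronglyMeasurable]
  have hμ1 : IsProbabilityMeasure μ := by
    refine ⟨?_⟩
    rw [hμ, withDensity_apply _ MeasurableSet.univ, Measure.restrict_univ,
      ← ofReal_integral_eq_lintegral_ofReal hθi (Filter.Eventually.of_forall hθ0), hθ1,
      ENNReal.ofReal_one]
  refine ⟨μ, hμ1, hμ ▸ regular_withDensity_of_hasCompactSupport ρ hθ hθs, fun a ha s hs => ?_⟩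
  obtain ⟨b, hbF, hab⟩ := Set.mem_iUnion₂.1 (hF ha)
  have hθai : Integrable (fun t => c a * θ (a⁻¹ * t)) ρ :=
    (by fun_prop : Continuous fun t => c a * θ (a⁻¹ * t)).integrable_of_hasCompactSupport
      (hθs.comp_homeomorph (Homeomorph.mulLeft a⁻¹)).mul_left
  have h1 : (μ.map (a * ·)).real s = ∫ t in s, c a * θ (a⁻¹ * t) ∂ρ := by
    have hm : Measurable (a * · : H → H) := (continuous_const_mul a).measurable
    rw [map_measureReal_apply hm hs, hμs _ (hm hs), ← integral_indicator (hm hs), ← hc a,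
      ← integral_const_mul, ← integral_indicator hs]
    refine integral_congr_ae (Filter.Eventually.of_forall fun t => ?_)
    by_cases ht : t ∈ s <;> simp [Set.indicator, ht]
  -- Here `b` is the centre near `a` in the finite cover of `Q`. The first sum is small by the
  -- choice of weights; the second because right translations preserve the L¹ distance of `ψ a` and
  -- `ψ b`.
  have hd : ∀ t, c a * θ (a⁻¹ * t) - θ t = (∑ j, w j * (ψ b (t * h j) - φ (t * h j)))
      + ∑ j, w j * (ψ a (t * h j) - ψ b (t * h j)) := fun t => by
    simp only [θ, ψ, Finset.mul_sum, ← Finset.sum_sub_distrib, ← Finset.sum_add_distrib]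
    refine Finset.sum_congr rfl fun j _ => ?_
    rw [mul_assoc a⁻¹]
    ring
  have hi1 : Integrable (fun t => ∑ j, w j * (ψ b (t * h j) - φ (t * h j))) ρ :=
    integrable_finsetSum _ fun j _ => (((hψi b).sub hφi).comp_mul_right (h j)).const_mul (w j)
  have hi2' : ∀ j, Integrable (fun t => w j * |ψ a (t * h j) - ψ b (t * h j)|) ρ := fun j =>
    ((((hψi a).sub (hψi b)).abs.comp_mul_right (h j)).const_mul (w j))
  have hi2 : Integrable (fun t => ∑ j, w j * |ψ a (t * h j) - ψ b (t * h j)|) ρ :=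
    integrable_finsetSum _ fun j _ => hi2' j
  rw [h1, hμs s hs, ← integral_sub hθai.integrableOn hθi.integrableOn]
  calc |∫ t in s, (c a * θ (a⁻¹ * t) - θ t) ∂ρ|
      ≤ ∫ t in s, |c a * θ (a⁻¹ * t) - θ t| ∂ρ := abs_integral_le_integral_abs
    _ ≤ ∫ t, |c a * θ (a⁻¹ * t) - θ t| ∂ρ :=
      setIntegral_le_integral (hθai.sub hθi).abs
        (Filter.Eventually.of_forall fun t => abs_nonneg _)
    _ ≤ ∫ t, (|∑ j, w j * (ψ b (t * h j) - φ (t * h j))|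
          + ∑ j, w j * |ψ a (t * h j) - ψ b (t * h j)|) ∂ρ := by
      refine integral_mono (hθai.sub hθi).abs (hi1.abs.add hi2) fun t => ?_
      simp only
      rw [hd]
      refine (abs_add_le _ _).trans (add_le_add le_rfl ?_)
      refine (Finset.abs_sum_le_sum_abs _ _).trans (Finset.sum_le_sum fun j _ => ?_)
      rw [abs_mul, abs_of_nonneg (hw j)]
    _ = ∫ t, |∑ j, w j * (ψ b (t * h j) - φ (t * h j))| ∂ρ
          + ∑ j, w j * ∫ t, |ψ a t - ψ b t| ∂ρ := by
      rw [integral_add hi1.abs hi2, integral_finsetSum _ fun j _ => hi2' j]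
      congr 1
      refine Finset.sum_congr rfl fun j _ => ?_
      rw [integral_const_mul, integral_mul_right_eq_self (μ := ρ) (fun t => |ψ a t - ψ b t|)]
    _ ≤ ε / 2 + ε / 2 := by
      refine add_le_add (hwh ⟨b, hbF⟩) ?_
      rw [← Finset.sum_mul, hw1, one_mul]
      exact le_of_lt hab
    _ = ε := add_halves ε

/-! ### Total variation estimates -/

/-- The factor 2 counts the two halves of a Hahn decomposition, each bounded by `ε`. -/
theorem tvDist_le_of_forall_abs_sub_le {X : Type*} [MeasurableSpace X] {μ ν : Measure X}
    [IsFiniteMeasure μ] [IsFiniteMeasure ν] {ε : ℝ}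
    (h : ∀ s, MeasurableSet s → |μ.real s - ν.real s| ≤ ε) :
    tvDist μ ν ≤ ENNReal.ofReal (2 * ε) := by
  have hε : 0 ≤ ε := (abs_nonneg _).trans (h ∅ MeasurableSet.empty)
  have hD : ∀ s, MeasurableSet s → |(μ.toSignedMeasure - ν.toSignedMeasure) s| ≤ ε :=
    fun s hs => by
      rw [_root_.sub_apply, Measure.toSignedMeasure_apply_measurable hs,
        Measure.toSignedMeasure_apply_measurable hs]
      exact h s hs
  unfold tvDist
  obtain ⟨s, hs, hpos, hneg, hp, hn⟩ := SignedMeasure.toJordanDecomposition_spec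
    (μ.toSignedMeasure - ν.toSignedMeasure)
  rw [SignedMeasure.totalVariation, Measure.add_apply, hp, hn,
    SignedMeasure.toMeasureOfZeroLE_apply _ hpos hs MeasurableSet.univ,
    SignedMeasure.toMeasureOfLEZero_apply _ hneg hs.compl MeasurableSet.univ,
    two_mul, ENNReal.ofReal_add hε hε, ← ENNReal.ofReal_eq_coe_nnreal,
    ← ENNReal.ofReal_eq_coe_nnreal]
  refine add_le_add (ENNReal.ofReal_le_ofReal ?_) (ENNReal.ofReal_le_ofReal ?_)
  · rw [Set.inter_univ]; exact (le_abs_self _).trans (hD s hs)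
  · rw [Set.inter_univ]; exact (neg_le_abs _).trans (hD _ hs.compl)

theorem abs_integral_sub_integral_le_tvDist {X : Type*} [MeasurableSpace X] {μ ν : Measure X}
    [IsFiniteMeasure μ] [IsFiniteMeasure ν] {f : X → ℝ} (hf : Measurable f) {C : ℝ}
    (hC : ∀ x, |f x| ≤ C) :
    |∫ x, f x ∂μ - ∫ x, f x ∂ν| ≤ C * (tvDist μ ν).toReal := by
  unfold tvDist
  set D := μ.toSignedMeasure - ν.toSignedMeasure with hD
  set p := D.toJordanDecomposition.posPart with hp
  set n := D.toJordanDecomposition.negPart with hn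
  have hD' : p.toSignedMeasure - n.toSignedMeasure = D := D.toSignedMeasure_toJordanDecomposition
  -- The Jordan decomposition rewritten as an identity of positive measures, which can be integrated
  -- against `f`.
  have hsum : μ + n = ν + p := by
    rw [← Measure.toSignedMeasure_eq_toSignedMeasure_iff, Measure.toSignedMeasure_add,
      Measure.toSignedMeasure_add, add_comm ν.toSignedMeasure, ← sub_eq_sub_iff_add_eq_add, ← hD, hD']
  have hint : ∀ (m : Measure X) [IsFiniteMeasure m], Integrable f m := fun m _ =>
    Integrable.of_bound hf.aestronglyMeasurable C (Filter.Eventually.of_forall hC)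
  have h1 : ∫ x, f x ∂μ + ∫ x, f x ∂n = ∫ x, f x ∂ν + ∫ x, f x ∂p := by
    rw [← integral_add_measure (hint _) (hint _), hsum, integral_add_measure (hint _) (hint _)]
  have h2 : ∀ (m : Measure X) [IsFiniteMeasure m], |∫ x, f x ∂m| ≤ C * m.real Set.univ :=
    fun m _ => by
      have := norm_integral_le_of_norm_le_const (μ := m) (f := f) (C := C)
        (Filter.Eventually.of_forall hC)
      rwa [Real.norm_eq_abs] at this
  have h3 : (D.totalVariation Set.univ).toReal = p.real Set.univ + n.real Set.univ := by
    rw [SignedMeasure.totalVariation, Measure.add_apply,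
      ENNReal.toReal_add (measure_ne_top _ _) (measure_ne_top _ _)]
    rfl
  have h4 : ∫ x, f x ∂μ - ∫ x, f x ∂ν = ∫ x, f x ∂p - ∫ x, f x ∂n := by linarith
  rw [h4, h3, mul_add]
  exact (abs_sub _ _).trans (add_le_add (h2 p) (h2 n))

/-! ### Actions satisfying (i): discrete quotients and compact spaces -/

/-- With a section σ, the cocycle σ(sx)⁻¹ s σ(x) takes values in `A` and is continuous, as the
quotient is discrete; hence it maps `C` to a compact subset of `A`. Translating a Reiter measure for
that set by σ(x) gives mˣ, and the defect s mˣ − m^{sx} is the translate of the defect of the Reiter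
measure under the cocycle. -/
theorem IsAmenableAction.quotient {G : Type u} [Group G] [TopologicalSpace G] [IsTopologicalGroup G]
    [LocallyCompactSpace G] [T2Space G] [MeasurableSpace G] [BorelSpace G] {A : Subgroup G}
    (hAo : IsOpen (A : Set G)) (hA : IsAmenableGroup A) : IsAmenableAction G (G ⧸ A) := by
  intro C hC ε hε
  have : DiscreteTopology (G ⧸ A) := QuotientGroup.discreteTopology hAo
  have : LocallyCompactSpace A := hAo.locallyCompactSpace
  let σ : G ⧸ A → G := Quotient.out
  have hσ : ∀ x, ((σ x : G) : G ⧸ A) = x := fun x => QuotientGroup.out_eq' x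
  have hσc : Continuous σ := continuous_of_discreteTopology
  have hmem : ∀ p : (G ⧸ A) × G, (σ (p.2 • p.1))⁻¹ * (p.2 * σ p.1) ∈ A := fun p => by
    rw [← QuotientGroup.eq, hσ]
    conv_lhs => rw [← hσ p.1]
    rfl
  let F : (G ⧸ A) × G → A := fun p => ⟨(σ (p.2 • p.1))⁻¹ * (p.2 * σ p.1), hmem p⟩
  have hF : Continuous F := by
    refine Continuous.subtype_mk ?_ _
    exact (hσc.comp (continuous_snd.smul continuous_fst)).inv.mul
      (continuous_snd.mul (hσc.comp continuous_fst))
  obtain ⟨μ, hμ, hμr, hμQ⟩ := hA.exists_almost_invariant_measure (hC.image hF) (half_pos hε)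
  have hj : ∀ g : G, Continuous fun a : A => g * (a : G) := fun g => by fun_prop
  let m : G ⧸ A → Measure G := fun x => μ.map fun a : A => σ x * (a : G)
  have hmp : ∀ x, IsProbabilityMeasure (m x) := fun x =>
    Measure.isProbabilityMeasure_map (hj _).measurable.aemeasurable
  have hm : IsContinuousProbMap m :=
    { isProbabilityMeasure := hmp
      regular := fun x => by
        have : (m x).InnerRegular := Measure.InnerRegular.map_of_continuous (hj _)
        have := hmp x
        infer_instance
      continuous_integral := fun f => continuous_of_discreteTopology }
  refine ⟨m, hm, fun p hp => ?_⟩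
  have := hmp
  refine (tvDist_le_of_forall_abs_sub_le (ε := ε / 2) fun s hs => ?_).trans_eq
    (by rw [mul_div_cancel₀ _ two_ne_zero])
  have hs' : MeasurableSet ((fun a : A => σ (p.2 • p.1) * (a : G)) ⁻¹' s) := (hj _).measurable hs
  have h1 : (m (p.2 • p.1)).real s = μ.real ((fun a : A => σ (p.2 • p.1) * (a : G)) ⁻¹' s) :=
    map_measureReal_apply (hj _).measurable hs
  have h2 : ((m p.1).map fun t => p.2 * t).real s
      = (μ.map (F p * ·)).real ((fun a : A => σ (p.2 • p.1) * (a : G)) ⁻¹' s) := by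
    rw [map_measureReal_apply (continuous_const_mul _).measurable hs,
      map_measureReal_apply (hj _).measurable ((continuous_const_mul _).measurable hs),
      map_measureReal_apply (continuous_const_mul _).measurable hs']
    congr 1
    ext a
    simp [F, mul_assoc]
  rw [h1, h2]
  exact hμQ _ ⟨p, hp, rfl⟩ _ hs'

theorem IsNormContinuousOnCb.of_compactSpace {G X : Type*} [Group G] [TopologicalSpace G]
    [IsTopologicalGroup G] [TopologicalSpace X] [CompactSpace X] [MulAction G X]
    [ContinuousSMul G X] : IsNormContinuousOnCb G X := by
  unfold IsNormContinuousOnCb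
  -- On a compact space the sup-norm topology is the compact-open one, where continuity follows by
  -- currying.
  let Φ : G × (X →ᵇ ℝ) → C(X, ℝ) := fun p => ⟨fun x => p.2 (p.1⁻¹ • x), by fun_prop⟩
  have hΦ : Continuous Φ := by
    refine ContinuousMap.continuous_of_continuous_uncurry _ ?_
    exact continuous_fst.snd.eval (continuous_fst.fst.inv.smul continuous_snd)
  exact (ContinuousMap.linearIsometryBoundedOfCompact X ℝ ℝ).continuous.comp hΦ

/-- By normality `A` acts trivially on the quotient, so the representation is locally constant in
the group variable; it is also isometric. -/
theorem IsNormContinuousOnCb.quotient {G : Type*} [Group G] [TopologicalSpace G]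
    [IsTopologicalGroup G] {A : Subgroup G} (hA : A.Normal) (hAo : IsOpen (A : Set G)) :
    IsNormContinuousOnCb G (G ⧸ A) := by
  unfold IsNormContinuousOnCb
  rw [continuous_iff_continuousAt]
  rintro ⟨g, f⟩
  have hcontr : ∀ f' : (G ⧸ A) →ᵇ ℝ, dist (cbTranslate g f') (cbTranslate g f) ≤ dist f' f :=
    fun f' => (BoundedContinuousFunction.dist_le dist_nonneg).2 fun x =>
      BoundedContinuousFunction.dist_coe_le_dist (f := f') (g := f) (g⁻¹ • x)
  have h1 : Filter.Tendsto (fun p : G × ((G ⧸ A) →ᵇ ℝ) => cbTranslate g p.2) (nhds (g, f))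
      (nhds (cbTranslate g f)) := by
    rw [tendsto_iff_dist_tendsto_zero]
    refine squeeze_zero (fun _ => dist_nonneg) (fun p => hcontr p.2) ?_
    rw [← tendsto_iff_dist_tendsto_zero]
    exact continuous_snd.tendsto _
  refine h1.congr' ?_
  have h2 : ∀ᶠ p : G × ((G ⧸ A) →ᵇ ℝ) in nhds (g, f), p.1⁻¹ * g ∈ A := by
    have : Continuous fun p : G × ((G ⧸ A) →ᵇ ℝ) => p.1⁻¹ * g := by fun_prop
    exact this.continuousAt.eventually_mem (hAo.mem_nhds (by simp [A.one_mem]))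
  filter_upwards [h2] with p hp
  ext x
  change p.2 (g⁻¹ • x) = p.2 (p.1⁻¹ • x)
  congr 1
  induction x using QuotientGroup.induction_on with
  | H y =>
    refine QuotientGroup.eq.2 ?_
    change (g⁻¹ * y)⁻¹ * (p.1⁻¹ * y) ∈ A
    have h3 := hA.conj_mem _ (hA.mem_comm hp) y⁻¹
    rw [inv_inv] at h3
    convert h3 using 1
    group

/-! ### Amenability of open subgroups with many fixed points -/

/-- An open subgroup maps equivariantly and continuously onto itself from the whole group. -/
theorem exists_continuous_equivariant_to_open_subgroup {G : Type*} [Group G] [TopologicalSpace G]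
    [IsTopologicalGroup G] {S : Subgroup G} (hS : IsOpen (S : Set G)) :
    ∃ τ : G → S, Continuous τ ∧ ∀ (h : S) (g : G), τ (h * g) = h * τ g := by
  have : DiscreteTopology (G ⧸ S) := QuotientGroup.discreteTopology hS
  -- `r g` depends only on the right coset `S g`, so `g * r g` is equivariant under left
  -- multiplication by `S`.
  let r : G → G := fun g => Quotient.out (QuotientGroup.mk g⁻¹ : G ⧸ S)
  have hr : ∀ g, g * r g ∈ S := fun g => by
    have h1 : ((g⁻¹ : G) : G ⧸ S) = ((r g : G) : G ⧸ S) := (QuotientGroup.out_eq' _).symm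
    simpa using QuotientGroup.eq.1 h1
  have hrc : Continuous r :=
    (continuous_of_discreteTopology (f := (Quotient.out : G ⧸ S → G))).comp
      (QuotientGroup.continuous_mk.comp continuous_inv)
  refine ⟨fun g => ⟨g * r g, hr g⟩, (continuous_id.mul hrc).subtype_mk _, fun h g => ?_⟩
  have h2 : r (h * g) = r g := by
    simp only [r]
    congr 1
    exact QuotientGroup.eq.2 (by simp [mul_assoc])
  apply Subtype.ext
  simp [h2, mul_assoc]

/-- If a group acts amenably, then an open subgroup all of whose finite subsets have a common
fixed point is amenable. -/
theorem IsAmenableAction.isAmenableGroup_of_finite_fixed {G : Type u} {X : Type*} [Group G]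
    [TopologicalSpace G] [IsTopologicalGroup G] [MeasurableSpace G] [BorelSpace G]
    [TopologicalSpace X] [MulAction G X] (hX : IsAmenableAction G X) {S : Subgroup G}
    (hS : IsOpen (S : Set G)) (hfix : ∀ F : Finset S, ∃ x : X, ∀ g ∈ F, (g : G) • x = x) :
    IsAmenableGroup S := by
  classical
  intro E _ _ _ _ _ _ _ K _ _ hKc hKconv hKne haff
  have : CompactSpace K := isCompact_iff_compactSpace.1 hKc
  have : Nonempty K := hKne.to_subtype
  have hlc : ∀ l : E →L[ℝ] ℝ, Continuous fun y : K => l y := fun l =>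
    l.continuous.comp continuous_subtype_val
  have hglc : ∀ (g : S) (l : E →L[ℝ] ℝ), Continuous fun y : K => l (g • y : K) := fun g l =>
    (hlc l).comp (continuous_const_smul g)
  -- The bound 1 suffices because `l` ranges over all functionals, hence over all multiples of each.
  -- By compactness only finitely many pairs need treatment.
  let Z : S × (E →L[ℝ] ℝ) → Set K := fun i => {y | |i.2 (i.1 • y : K) - i.2 y| ≤ 1}
  suffices hZ : (⋂ i, Z i).Nonempty by
    obtain ⟨y, hy⟩ := hZ
    rw [Set.mem_iInter] at hy
    refine ⟨y, fun g => Subtype.ext ?_⟩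
    by_contra hne
    obtain ⟨l, hl⟩ := SeparatingDual.exists_separating_of_ne (R := ℝ) hne
    have hpos : 0 < |l (g • y : K) - l y| := abs_pos.2 (sub_ne_zero.2 hl)
    have h1 := hy (g, (2 / |l (g • y : K) - l y|) • l)
    simp only [Z, Set.mem_ofPred_eq, _root_.smul_apply, smul_eq_mul] at h1
    rw [← mul_sub, abs_mul, abs_of_pos (by positivity), div_mul_cancel₀ _ hpos.ne'] at h1
    norm_num at h1
  refine CompactSpace.iInter_nonempty (fun i => isClosed_le
    ((hglc i.1 i.2).sub (hlc i.2)).abs continuous_const) fun t => ?_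
  -- `true` records l(g y) and `false` records l(y). The image is a finite-dimensional compact
  -- convex set, so averages of `Ψ` are attained at points of `K`.
  let Ψ : K → (t × Bool → ℝ) := fun y i =>
    cond i.2 (i.1.1.2 (i.1.1.1 • y : K)) (i.1.1.2 y)
  have hΨ : Continuous Ψ := by
    refine continuous_pi fun i => ?_
    obtain ⟨i, _ | _⟩ := i
    · exact hlc _
    · exact hglc _ _
  have hconv : Convex ℝ (Set.range Ψ) := by
    rintro _ ⟨y, rfl⟩ _ ⟨z, rfl⟩ a b ha hb hab
    refine ⟨⟨a • (y : E) + b • (z : E), hKconv y.2 z.2 ha hb hab⟩, funext fun i => ?_⟩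
    obtain ⟨i, _ | _⟩ := i
    · simp [Ψ]
    · have := haff i.1.1 y z ⟨a • (y : E) + b • (z : E), hKconv y.2 z.2 ha hb hab⟩ a b ha hb hab rfl
      simp [Ψ, this]
  obtain ⟨C, hC⟩ := isCompact_univ.exists_bound_of_continuousOn hΨ.continuousOn
  have hC' : ∀ y, ‖Ψ y‖ ≤ C := fun y => hC y (Set.mem_univ y)
  obtain ⟨y₀⟩ := ‹Nonempty K›
  have hC0 : 0 ≤ C := (norm_nonneg _).trans (hC' y₀)
  obtain ⟨x, hx⟩ := hfix (t.image Prod.fst)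
  -- The tolerance is chosen so that `C * (C + 1)⁻¹ ≤ 1`, with `C` bounding `Ψ`.
  obtain ⟨m, hm, hmx⟩ := hX ((fun g : S => (x, (g : G))) '' (t.image Prod.fst : Finset S))
    ((Finset.finite_toSet _).image _).isCompact (C + 1)⁻¹ (by positivity)
  have hmp := hm.isProbabilityMeasure
  obtain ⟨τ, hτ, hτe⟩ := exists_continuous_equivariant_to_open_subgroup hS
  let φ : G → K := fun g => τ g • y₀
  have hφ : Continuous φ := hτ.smul continuous_const
  have hφe : ∀ (h : S) (g : G), φ (h * g) = h • φ g := fun h g => by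
    simp only [φ, hτe, mul_smul]
  have hint : Integrable (fun g => Ψ (φ g)) (m x) :=
    Integrable.of_bound (hΨ.comp hφ).aestronglyMeasurable C
      (Filter.Eventually.of_forall fun g => hC' _)
  obtain ⟨y, hy⟩ := hconv.integral_mem (isCompact_range hΨ).isClosed
    (Filter.Eventually.of_forall fun g => ⟨φ g, rfl⟩) hint
  have hyi : ∀ i, Ψ y i = ∫ g, Ψ (φ g) i ∂(m x) := fun i => by
    rw [hy]
    exact eval_integral (fun j => hint.eval j) i
  refine ⟨y, Set.mem_iInter₂.2 fun i hi => ?_⟩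
  have h1 := hyi (⟨i, hi⟩, true)
  have h2 := hyi (⟨i, hi⟩, false)
  change i.2 (i.1 • y : K) = ∫ g, i.2 (i.1 • φ g : K) ∂(m x) at h1
  change i.2 y = ∫ g, i.2 (φ g) ∂(m x) at h2
  change |i.2 (i.1 • y : K) - i.2 y| ≤ 1
  have hmem : i.1 ∈ t.image Prod.fst := Finset.mem_image_of_mem _ hi
  have h3 := hmx (x, (i.1 : G)) ⟨i.1, hmem, rfl⟩
  have hlφ : Continuous fun g => i.2 (φ g) := (hlc i.2).comp hφ
  have h4 := abs_integral_sub_integral_le_tvDist (μ := (m x).map fun t => (i.1 : G) * t)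
    (ν := m ((i.1 : G) • x)) hlφ.measurable (C := C) fun g =>
      (norm_le_pi_norm (Ψ (φ g)) (⟨i, hi⟩, false)).trans (hC' _)
  have h5 : ∫ g, i.2 (φ g) ∂((m x).map fun t => (i.1 : G) * t)
      = ∫ g, i.2 (i.1 • φ g : K) ∂(m x) := by
    rw [integral_map (continuous_const_mul _).measurable.aemeasurable
      hlφ.aestronglyMeasurable]
    simp only [hφe]
  have h6 := ENNReal.toReal_mono ENNReal.ofReal_ne_top h3
  rw [ENNReal.toReal_ofReal (by positivity)] at h6
  have h7 := h4.trans (mul_le_mul_of_nonneg_left h6 hC0)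
  rw [hx _ hmem] at h7
  rw [h1, h2, ← h5]
  refine h7.trans ?_
  rw [← div_eq_mul_inv, div_le_one (by positivity)]
  linarith

/-! ### Consequences of norm continuity at infinity -/

/-- Sequences escaping to infinity, whose translates by a compact set are pairwise disjoint and
locally finite, chosen recursively subject to a relation. -/
theorem exists_escaping_seq {G X T : Type*} [Group G] [TopologicalSpace G] [IsTopologicalGroup G]
    [TopologicalSpace X] [LocallyCompactSpace X] [SigmaCompactSpace X] [MulAction G X]
    [ContinuousSMul G X] {V : Set G} (hV : IsCompact V) (p : T → X) (r : T → T → Prop)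
    (h : ∀ (s : Finset T) (C : Set X), IsCompact C → ∃ y, p y ∉ C ∧ ∀ z ∈ s, r z y) :
    ∃ y : ℕ → T, LocallyFinite (fun n => (· • p (y n)) '' V) ∧
      (∀ m n, m < n → Disjoint ((· • p (y m)) '' V) ((· • p (y n)) '' V)) ∧
      ∀ m n, m < n → r (y m) (y n) := by
  classical
  let K : CompactExhaustion X := default
  have hVx : ∀ x : X, IsCompact ((· • x) '' V : Set X) := fun x =>
    hV.image (continuous_id.smul continuous_const)
  let R : T × ℕ → T × ℕ → Prop := fun a b => r a.1 b.1 ∧ a.2 < b.2 ∧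
    (· • p a.1) '' V ⊆ K b.2 ∧ Disjoint ((· • p b.1) '' V) (K b.2)
  obtain ⟨f, -, hf⟩ := exists_seq_of_forall_finset_exists (fun _ : T × ℕ => True) R fun s _ => by
    obtain ⟨n, hn⟩ := K.exists_superset_of_isCompact
      (s.isCompact_biUnion fun a _ => hVx (p a.1))
    let l := max n (s.sup Prod.snd + 1)
    -- The set to avoid is V⁻¹ K_l: a point off it has its `V`-translates off `K l`, which contains
    -- the translates of all earlier points.
    obtain ⟨y, hy, hys⟩ := h (s.image Prod.fst) ((fun q : G × X => q.1⁻¹ • q.2) '' (V ×ˢ K l))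
      ((hV.prod (K.isCompact l)).image (continuous_fst.inv.smul continuous_snd))
    refine ⟨(y, l), trivial, fun a ha => ⟨hys _ (Finset.mem_image_of_mem _ ha), ?_, ?_, ?_⟩⟩
    · exact (Nat.lt_succ_of_le (Finset.le_sup (f := Prod.snd) ha)).trans_le (le_max_right _ _)
    · exact ((Set.subset_biUnion_of_mem (u := fun a : T × ℕ => (· • p a.1) '' V) ha).trans hn).trans
        (K.subset (le_max_left _ _))
    · rw [Set.disjoint_left]
      rintro _ ⟨v, hv, rfl⟩ hvK
      exact hy ⟨(v, v • p y), ⟨hv, hvK⟩, by simp⟩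
  have hmono : ∀ n, n ≤ (f n).2 := fun n => by
    induction n with
    | zero => exact Nat.zero_le _
    | succ n ih => exact ih.trans_lt (hf n (n + 1) n.lt_succ_self).2.1
  refine ⟨fun n => (f n).1, fun x => ?_, fun m n hmn => ?_, fun m n hmn => (hf m n hmn).1⟩
  · obtain ⟨j, hj⟩ := K.exists_mem x
    refine ⟨K (j + 1), mem_interior_iff_mem_nhds.1 (K.subset_interior_succ j hj),
      (Set.finite_Iic j).subset fun n hn => ?_⟩
    by_contra! hjn
    have hjn' : j < n := not_le.1 hjn
    have h1 := (hf 0 n (j.zero_le.trans_lt hjn')).2.2.2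
    obtain ⟨z, hz, hzK⟩ := hn
    exact Set.disjoint_left.1 h1 hz (K.subset (Nat.succ_le_of_lt hjn' |>.trans (hmono n)) hzK)
  · exact (hf m n hmn).2.2.2.symm.mono_left (hf m n hmn).2.2.1

/-- Norm continuity prevents points escaping to infinity from being moved by elements
close to the identity. -/
theorem IsNormContinuousOnCb.exists_nhds_one_forall_notMem {G X : Type*} [Group G]
    [TopologicalSpace G] [IsTopologicalGroup G] [TopologicalSpace X] [LocallyCompactSpace X]
    [SigmaCompactSpace X] [T2Space X] [MulAction G X] [ContinuousSMul G X]
    (hN : IsNormContinuousOnCb G X) {V : Set G} (hV1 : (1 : G) ∈ V) {x : ℕ → X}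
    (hlf : LocallyFinite (fun n => (· • x n) '' V))
    (hdisj : ∀ m n, m < n → Disjoint ((· • x m) '' V) ((· • x n) '' V)) {P : ℕ → Set G}
    (hPV : ∀ n, P n ⊆ V) (hP : ∀ n, IsCompact (P n)) (hPx : ∀ n, ∀ g ∈ P n, g • x n ≠ x n) :
    ∃ U ∈ nhds (1 : G), ∀ n, ∀ g ∈ U, g ∉ P n := by
  have hxV : ∀ n, x n ∈ (· • x n) '' V := fun n => ⟨1, hV1, one_smul _ _⟩
  have hA : IsClosed (⋃ n, {x n}) :=
    (hlf.subset fun n => Set.singleton_subset_iff.2 (hxV n)).isClosed_iUnion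
      fun n => isClosed_singleton
  have hB : IsClosed (⋃ n, (· • x n) '' P n) :=
    (hlf.subset fun n => Set.image_mono (hPV n)).isClosed_iUnion fun n =>
      ((hP n).image (continuous_id.smul continuous_const)).isClosed
  have hAB : Disjoint (⋃ n, (· • x n) '' P n) (⋃ n, {x n}) := by
    simp only [Set.disjoint_iUnion_right, Set.disjoint_singleton_right, Set.mem_iUnion]
    rintro n ⟨m, g, hg, hgx⟩
    rcases lt_trichotomy m n with hmn | rfl | hmn
    · exact Set.disjoint_left.1 (hdisj _ _ hmn) ⟨g, hPV m hg, hgx⟩ (hxV n)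
    · exact hPx _ g hg hgx
    · exact Set.disjoint_left.1 (hdisj _ _ hmn) (hxV n) ⟨g, hPV m hg, hgx⟩
  -- Each element of `P n` moves `x n` from a point where `f` is 1 to one where it is 0, hence moves
  -- `F` by at least 1 in norm.
  obtain ⟨f, hf0, hf1, hf01⟩ := exists_continuous_zero_one_of_isClosed hB hA hAB
  let F : X →ᵇ ℝ := BoundedContinuousFunction.ofNormedAddCommGroup f f.continuous 1 fun t => by
    rw [Real.norm_eq_abs, abs_le]
    exact ⟨by linarith [(hf01 t).1], (hf01 t).2⟩
  have hcont : Continuous fun g : G => cbTranslate g⁻¹ F :=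
    hN.comp (continuous_inv.prodMk continuous_const)
  refine ⟨_, hcont.continuousAt (Metric.ball_mem_nhds (cbTranslate 1⁻¹ F) one_pos),
    fun n g hg hgP => ?_⟩
  have h1 := (BoundedContinuousFunction.dist_coe_le_dist (f := cbTranslate g⁻¹ F)
    (g := cbTranslate 1⁻¹ F) (x n)).trans_lt hg
  have h2 : cbTranslate g⁻¹ F (x n) = 0 := by
    change f (g⁻¹⁻¹ • x n) = 0
    rw [inv_inv]
    exact hf0 (Set.mem_iUnion.2 ⟨n, g, hgP, rfl⟩)
  have h3 : cbTranslate (1 : G)⁻¹ F (x n) = 1 := by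
    change f ((1 : G)⁻¹⁻¹ • x n) = 1
    rw [inv_inv, one_smul]
    exact hf1 (Set.mem_iUnion.2 ⟨n, rfl⟩)
  rw [h2, h3] at h1
  norm_num at h1

/-- If `G` acts continuously in norm on `C_b(X)`, then some neighbourhood of the identity acts
trivially off a compact set. -/
theorem IsNormContinuousOnCb.exists_isCompact_fixed_mem_nhds {G X : Type*} [Group G]
    [TopologicalSpace G] [IsTopologicalGroup G] [LocallyCompactSpace G] [T2Space G]
    [TopologicalSpace X] [LocallyCompactSpace X]
    [SigmaCompactSpace X] [T2Space X] [MulAction G X] [ContinuousSMul G X]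
    (hN : IsNormContinuousOnCb G X) :
    ∃ C : Set X, IsCompact C ∧ {g : G | ∀ x ∉ C, g • x = x} ∈ nhds (1 : G) := by
  borelize G
  by_contra! hcon
  obtain ⟨V, hV, hV1⟩ := exists_compact_mem_nhds (1 : G)
  have hstab : ∀ x : X, IsClosed (MulAction.stabilizer G x : Set G) := fun x =>
    isClosed_eq (continuous_id.smul continuous_const) continuous_const
  -- Either points with non-open stabiliser escape to infinity, which Haar measure excludes, or all
  -- stabilisers are open off a compact set, and a cluster point argument applies.
  by_cases hcase : ∀ C : Set X, IsCompact C →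
      ∃ x ∉ C, (MulAction.stabilizer G x : Set G) ∉ nhds 1
  · obtain ⟨y, hlf, hdisj, -⟩ := exists_escaping_seq hV
      (fun x : {x : X // (MulAction.stabilizer G x : Set G) ∉ nhds 1} => (x : X))
      (fun _ _ => True) fun s C hC => by
        obtain ⟨x, hx, hxs⟩ := hcase C hC
        exact ⟨⟨x, hxs⟩, hx, fun _ _ => trivial⟩
    let μ : Measure G := Measure.haar
    let W := interior V
    have hW1 : W ∈ nhds 1 := interior_mem_nhds.2 hV1
    have hWfin : μ W ≠ ⊤ := ((measure_mono interior_subset).trans_lt hV.measure_lt_top).ne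
    -- Steinhaus: a subgroup meeting `W` in positive measure contains a neighbourhood of 1.
    have hnull : ∀ n, μ (W ∩ MulAction.stabilizer G (y n : X)) = 0 := fun n => by
      by_contra hne
      refine (y n).2 (Filter.mem_of_superset (Measure.div_mem_nhds_one_of_haar_pos_ne_top μ
        (W ∩ MulAction.stabilizer G (y n : X))
        (isOpen_interior.measurableSet.inter (hstab _).measurableSet) (pos_iff_ne_zero.2 hne)
        ((measure_mono Set.inter_subset_left).trans_lt hWfin.lt_top).ne) ?_)
      rintro _ ⟨a, ha, b, hb, rfl⟩
      exact div_mem ha.2 hb.2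
    have hP : ∀ n : ℕ, ∃ P ⊆ W \ MulAction.stabilizer G (y n : X), IsCompact P ∧
        μ ((W \ MulAction.stabilizer G (y n : X)) \ P) < ((n : ENNReal) + 1)⁻¹ := fun n =>
      (isOpen_interior.measurableSet.diff (hstab _).measurableSet).exists_isCompact_sdiff_lt
        ((measure_mono Set.sdiff_subset).trans_lt hWfin.lt_top).ne (by simp)
    choose P hPW hPc hPμ using hP
    obtain ⟨U, hU, hUP⟩ := hN.exists_nhds_one_forall_notMem (mem_of_mem_nhds hV1) hlf hdisj
      (fun n => (hPW n).trans (Set.sdiff_subset.trans interior_subset)) hPc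
      fun n g hg => (hPW n hg).2
    -- `P n` fills `W` up to measure 1/(n+1) and `U` misses every `P n`, so the neighbourhood `U ∩
    -- W` would be null.
    have hUW : ∀ n : ℕ, μ (U ∩ W) ≤ ((n : ENNReal) + 1)⁻¹ := fun n =>
      calc μ (U ∩ W) ≤ μ ((W ∩ MulAction.stabilizer G (y n : X)) ∪
            ((W \ MulAction.stabilizer G (y n : X)) \ P n)) := by
            refine measure_mono fun g hg => ?_
            by_cases hgs : g ∈ (MulAction.stabilizer G (y n : X) : Set G)
            · exact Or.inl ⟨hg.2, hgs⟩
            · exact Or.inr ⟨⟨hg.2, hgs⟩, hUP n g hg.1⟩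
        _ ≤ _ := measure_union_le _ _
        _ ≤ ((n : ENNReal) + 1)⁻¹ := by rw [hnull, zero_add]; exact (hPμ n).le
    have hpos : 0 < μ (U ∩ W) := Measure.measure_pos_of_mem_nhds μ (Filter.inter_mem hU hW1)
    obtain ⟨n, hn⟩ := ENNReal.exists_inv_nat_lt hpos.ne'
    exact ((hUW n).trans (ENNReal.inv_le_inv.2 le_self_add)).not_gt hn
  · push Not at hcase
    obtain ⟨C₀, hC₀, hopen⟩ := hcase
    -- Each term is a point together with an element of `V` that moves it but fixes all earlier
    -- points; finite intersections of open stabilisers provide it.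
    obtain ⟨y, hlf, hdisj, hr⟩ := exists_escaping_seq hV
      (fun t : {t : X × G // t.1 ∉ C₀ ∧ t.2 ∈ V ∧ t.2 • t.1 ≠ t.1} => t.1.1)
      (fun z t => t.1.2 • z.1.1 = z.1.1) fun s C hC => by
        have hO : (⋂ z ∈ s, (MulAction.stabilizer G z.1.1 : Set G)) ∩ V ∈ nhds 1 :=
          Filter.inter_mem ((Filter.biInter_finset_mem s).2 fun z _ => hopen _ z.2.1) hV1
        have hne : ¬ (⋂ z ∈ s, (MulAction.stabilizer G z.1.1 : Set G)) ∩ V ⊆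
            {g : G | ∀ x ∉ C ∪ C₀, g • x = x} := fun hsub =>
          hcon _ (hC.union hC₀) (Filter.mem_of_superset hO hsub)
        obtain ⟨g, ⟨hgs, hgV⟩, hg⟩ := Set.not_subset.1 hne
        simp only [Set.mem_ofPred_eq, not_forall] at hg
        obtain ⟨x, hx, hgx⟩ := hg
        refine ⟨⟨(x, g), fun h => hx (Or.inr h), hgV, hgx⟩, fun h => hx (Or.inl h), fun z hz => ?_⟩
        exact Set.mem_iInter₂.1 hgs z hz
    obtain ⟨U, hU, hUP⟩ := hN.exists_nhds_one_forall_notMem (mem_of_mem_nhds hV1) hlf hdisj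
      (P := fun n => V \ MulAction.stabilizer G (y n).1.1) (fun n => Set.sdiff_subset)
      (fun n => hV.diff (Subgroup.isOpen_of_mem_nhds _ (hopen _ (y n).2.1)))
      fun n g hg => hg.2
    -- Clustering in `V` gives m < n with g_m⁻¹ g_n in `U ∩ V`, hence fixing x_m. As g_n also fixes
    -- x_m, so does g_m, a contradiction.
    obtain ⟨c, -, hc⟩ := hV.exists_mapClusterPt (f := Filter.atTop) (u := fun n => (y n).1.2)
      (Filter.le_principal_iff.2 (Filter.mem_map.2 (Filter.univ_mem' fun n => (y n).2.2.1)))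
    have hcc : ∀ᶠ q : G × G in nhds (c, c), q.1⁻¹ * q.2 ∈ U ∩ V := by
      have : Continuous fun q : G × G => q.1⁻¹ * q.2 := by fun_prop
      exact this.continuousAt.eventually_mem (by simpa using Filter.inter_mem hU hV1)
    rw [nhds_prod_eq, Filter.eventually_prod_self_iff'] at hcc
    obtain ⟨W, hW, hWU⟩ := hcc
    have hfreq := hc.frequently hW
    obtain ⟨m, hm⟩ := hfreq.exists
    obtain ⟨n, hmn, hn⟩ := (Filter.frequently_atTop'.1 hfreq) m
    have h1 := hWU _ hm _ hn
    have h2 : (y m).1.2⁻¹ * (y n).1.2 ∈ MulAction.stabilizer G (y m).1.1 := by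
      by_contra hns
      exact hUP m _ h1.1 ⟨h1.2, hns⟩
    have h3 : (y n).1.2 ∈ MulAction.stabilizer G (y m).1.1 := hr m n hmn
    have h4 : (y m).1.2 ∈ MulAction.stabilizer G (y m).1.1 := by
      have := mul_mem h3 (inv_mem h2)
      simpa using this
    exact (y m).2.2.2 h4

/-! ### The open normal subgroup and the equivalence -/

/-- The elements acting trivially off a compact set. -/
def compactlySupportedSubgroup (G X : Type*) [Group G] [TopologicalSpace X] [MulAction G X] :
    Subgroup G where
  carrier := {g | ∃ C : Set X, IsCompact C ∧ ∀ x ∉ C, g • x = x}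
  one_mem' := ⟨∅, isCompact_empty, fun x _ => one_smul G x⟩
  mul_mem' := by
    rintro g h ⟨C, hC, hg⟩ ⟨D, hD, hh⟩
    refine ⟨C ∪ D, hC.union hD, fun x hx => ?_⟩
    rw [mul_smul, hh x fun h => hx (Or.inr h), hg x fun h => hx (Or.inl h)]
  inv_mem' := by
    rintro g ⟨C, hC, hg⟩
    exact ⟨C, hC, fun x hx => inv_smul_eq_iff.2 (hg x hx).symm⟩

theorem compactlySupportedSubgroup_normal (G X : Type*) [Group G] [TopologicalSpace G]
    [TopologicalSpace X] [MulAction G X] [ContinuousSMul G X] :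
    (compactlySupportedSubgroup G X).Normal := by
  refine ⟨?_⟩
  rintro g ⟨C, hC, hg⟩ h
  refine ⟨(h • ·) '' C, hC.image (continuous_const_smul h), fun x hx => ?_⟩
  rw [mul_smul, mul_smul, hg, smul_inv_smul]
  exact fun hxC => hx ⟨_, hxC, smul_inv_smul h x⟩

theorem mainTheorem8 (G : Type u) [Group G] [TopologicalSpace G] [IsTopologicalGroup G]
    [LocallyCompactSpace G] [T2Space G] [SigmaCompactSpace G]
    [MeasurableSpace G] [BorelSpace G] :
    (∃ (X : Type u) (_ : TopologicalSpace X) (_ : MulAction G X) (_ : ContinuousSMul G X),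
      Nonempty X ∧ LocallyCompactSpace X ∧ T2Space X ∧ SigmaCompactSpace X ∧
        IsAmenableAction G X ∧ IsNormContinuousOnCb G X) ↔
    (IsAmenableAtInfinity G ∨ IsAmenableByDiscrete G) := by
  constructor
  · rintro ⟨X, _, _, _, hne, _, _, _, hX, hN⟩
    by_cases hc : CompactSpace X
    · exact Or.inl ⟨X, inferInstance, inferInstance, hne, hc, inferInstance, inferInstance, hX⟩
    · obtain ⟨C, hC, hCn⟩ := hN.exists_isCompact_fixed_mem_nhds
      have hopen : IsOpen (compactlySupportedSubgroup G X : Set G) :=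
        Subgroup.isOpen_of_mem_nhds _ (Filter.mem_of_superset hCn fun g hg => ⟨C, hC, hg⟩)
      refine Or.inr ⟨compactlySupportedSubgroup G X, compactlySupportedSubgroup_normal G X, hopen,
        hX.isAmenableGroup_of_finite_fixed hopen fun F => ?_⟩
      choose D hD hDfix using fun g : compactlySupportedSubgroup G X => g.2
      -- Non-compactness leaves a point outside the finitely many compact sets; all of `F` fixes it.
      obtain ⟨x, hx⟩ : ∃ x, x ∉ ⋃ g ∈ F, D g := by
        by_contra! hall
        exact hc ⟨(F.isCompact_biUnion fun g _ => hD g).of_isClosed_subset isClosed_univ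
          fun x _ => hall x⟩
      exact ⟨x, fun g hg => hDfix g x fun h => hx (Set.mem_biUnion hg h)⟩
  · rintro (⟨X, _, _, hne, _, _, _, hX⟩ | ⟨A, hA, hAo, hAam⟩)
    · exact ⟨X, inferInstance, inferInstance, inferInstance, hne, inferInstance, inferInstance,
        inferInstance, hX, IsNormContinuousOnCb.of_compactSpace⟩
    · have : DiscreteTopology (G ⧸ A) := QuotientGroup.discreteTopology hAo
      have : SigmaCompactSpace (G ⧸ A) := by
        rw [← isSigmaCompact_univ_iff, ← (QuotientGroup.mk_surjective (s := A)).range_eq]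
        exact isSigmaCompact_range QuotientGroup.continuous_mk
      exact ⟨G ⧸ A, inferInstance, inferInstance, inferInstance, inferInstance, inferInstance,
        inferInstance, inferInstance, IsAmenableAction.quotient hAo hAam,
        IsNormContinuousOnCb.quotient hA hAo⟩
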